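/- Let $R$ be a Dedekind domain (fields are allowed), let $M$ and $N$ be finitely generated $R$-modules, let $X:=\operatorname{Ass}_R(N)\setminus\{0\}$ be the set of nonzero associated primes of $N$, and let $t$ be a positive integer. Notation. For modules $P,Q$ over a ring $A$, $\operatorname{spl}_A(P,Q)\in\{0,1,2,\dots\}\cup\{\infty\}$ is the supremum of the nonnegative integers $n$ for which there is a split surjective $A$-linear map $P\to Q^{\oplus n}$. $\operatorname{Tor}(M)$ is the torsion submodule of $M$, and $\operatorname{rank}(M)$ is its rank. If $M\neq\operatorname{Tor}(M)$, then $M/\operatorname{Tor}(M)\cong R^{\oplus(\operatorname{rank}(M)-1)}\oplus I$ for a nonzero ideal $I$ of $R$ that is unique up to isomorphism, and $[M]$ denotes the class of $I$ in the class group of $R$ (the Steinitz class of $M$). Then $\operatorname{spl}_R(M,N)\geq t$ if and only if $\operatorname{spl}_{R_{\mathfrak m}}(M_{\mathfrak m},N_{\mathfrak m})\geq t$ for every $\mathfrak m\in X$ and one of the following conditions holds: 1. $\operatorname{rank}(N)=0$. 2. $\operatorname{rank}(M)\geq 1+t\cdot\operatorname{rank}(N)$. 3. $\operatorname{rank}(M)=t\cdot\operatorname{rank}(N)\geq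 t$, and $[M]=[N]^t$. Moreover, if $\operatorname{spl}_R(M,N)\geq t$ and (3) holds, then $\operatorname{spl}_R(\operatorname{Tor}(M),\operatorname{Tor}(N))\geq t$ and $\operatorname{spl}_R(M,N)=t$. -/

import Mathlib

open scoped nonZeroDivisors

universe u v w

/-- There is a split surjective `A`-linear map from `M` to the direct sum of `t` copies of `N`,
i.e. an `A`-linear map `M → N^t` that has an `A`-linear right inverse. -/
def HasSplitSurjection (A : Type u) [Ring A] (M : Type v) [AddCommGroup M] [Module A M]
    (N : Type w) [AddCommGroup N] [Module A N] (t : ℕ) : Prop :=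
  ∃ (f : M →ₗ[A] (Fin t → N)) (g : (Fin t → N) →ₗ[A] M), f ∘ₗ g = LinearMap.id

/-- The global splitting capacity of `M` with respect to `N` over `A`: the supremum in `ℕ∞` of the
nonnegative integers `t` for which there is a split surjective map from `M` to `N^t`. -/
noncomputable def splittingCapacity (A : Type u) [Ring A] (M : Type v) [AddCommGroup M] [Module A M]
    (N : Type w) [AddCommGroup N] [Module A N] : ℕ∞ :=
  sSup {n : ℕ∞ | ∃ t : ℕ, n = (t : ℕ∞) ∧ HasSplitSurjection A M N t}

/-- The local splitting capacity of `M` with respect to `N` over `R` at the prime `p`: the splitting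
capacity of `M_p` with respect to `N_p` over `R_p`. -/
noncomputable def localSplittingCapacity (R : Type u) [CommRing R] (p : Ideal R) [p.IsPrime]
    (M : Type v) [AddCommGroup M] [Module R M] (N : Type w) [AddCommGroup N] [Module R N] : ℕ∞ :=
  splittingCapacity (Localization.AtPrime p) (LocalizedModule.AtPrime p M)
    (LocalizedModule.AtPrime p N)

/-- `M / Tor(M) ≅ R^(r - 1) ⊕ I`, where `r` is the rank of `M`. -/
def IsSteinitzIdeal (R : Type u) [CommRing R] (M : Type v) [AddCommGroup M] [Module R M]
    (I : Ideal R) : Prop :=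
  Nonempty ((M ⧸ Submodule.torsion R M) ≃ₗ[R] (Fin (Module.finrank R M - 1) → R) × I)

open Classical in
/-- The Steinitz class of a finitely generated module `M` that is not torsion, over a Dedekind
domain `R`: the class of a nonzero ideal `I` with `M / Tor(M) ≅ R^(r - 1) ⊕ I`, where `r` is the
rank of `M`. Such an ideal exists, and its class is unique, by the structure theorem. When `M` is
torsion there is no such ideal, and the value is `1` by convention. -/
noncomputable def steinitzClass (R : Type u) [CommRing R] [IsDedekindDomain R]
    (M : Type v) [AddCommGroup M] [Module R M] : ClassGroup R :=
  if h : ∃ I : (Ideal R)⁰, IsSteinitzIdeal R M (I : Ideal R) then ClassGroup.mk0 h.choose else 1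

/-! Over a Dedekind domain `M` is the direct sum of `Tor(M)` and `M / Tor(M)`, so the two halves can
be treated separately.

Torsion half: `Tor(N)` is killed by a nonzero ideal, and the finitely many primes above that ideal
are associated primes of `N`. Local splittings there have their denominators cleared and are glued
by the Chinese remainder theorem (`LinearMap.exists_comp_eq_id_of_local`).

Torsion-free half: each nonzero quotient `M / Tor(M)` is `R^a ⊕ I`, and `I ⊕ J ≅ R ⊕ IJ` makes
classes multiply in direct sums. If `M` has spare rank, a complement can absorb any discrepancy of
classes. If the ranks agree, a surjection `M → N^t` has torsion kernel, so `M / Tor(M) ≅ (N /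
Tor(N))^t`; a determinant argument (`IsFreeProdIdeal.mk0_eq_mk0`) then forces equality of classes.
-/

section Splitting

variable {R : Type*} [Ring R] {P Q : Type*} [AddCommGroup P] [Module R P] [AddCommGroup Q]
  [Module R Q]

theorem LinearMap.nonempty_linearEquiv_ker_prod_of_comp_eq_id (f : P →ₗ[R] Q) (g : Q →ₗ[R] P)
    (h : f ∘ₗ g = LinearMap.id) : Nonempty (P ≃ₗ[R] f.ker × Q) :=
  ⟨((f.exact_subtype_ker_map).splitSurjectiveEquiv f.ker.injective_subtype ⟨g, h⟩).1⟩

theorem LinearMap.nonempty_linearEquiv_ker_prod_of_surjective [Module.Projective R Q]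
    (f : P →ₗ[R] Q) (h : Function.Surjective f) : Nonempty (P ≃ₗ[R] f.ker × Q) := by
  obtain ⟨g, hg⟩ := Module.projective_lifting_property f LinearMap.id h
  exact f.nonempty_linearEquiv_ker_prod_of_comp_eq_id g hg

end Splitting

/-! ### Isomorphisms of ideals and Steinitz's relation `I ⊕ J ≅ R ⊕ IJ`. -/

namespace Ideal

variable {R : Type*} [CommRing R]

/-- With `i + j = 1`, the addition map `I ⊕ J → R` is split by `r ↦ (ri, rj)`, and `(x, y) ↦ xj -
yi` is the matching projection onto its kernel, a copy of `IJ`. -/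
theorem nonempty_prod_linearEquiv_of_sup_eq_top {I J : Ideal R} (h : I ⊔ J = ⊤) :
    Nonempty ((I × J) ≃ₗ[R] R × (I * J : Ideal R)) := by
  obtain ⟨i, hi, j, hj, hij⟩ := Submodule.mem_sup.mp (h ▸ Submodule.mem_top : (1 : R) ∈ I ⊔ J)
  let f : (I × J) →ₗ[R] R × (I * J : Ideal R) :=
    { toFun := fun p ↦ (p.1.1 + p.2.1, ⟨p.1.1 * j - p.2.1 * i, sub_mem (mul_mem_mul p.1.2 hj)
        (mul_comm I J ▸ mul_mem_mul p.2.2 hi)⟩)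
      map_add' := fun p q ↦ Prod.ext
        (show (p.1.1 + q.1.1) + (p.2.1 + q.2.1) = (p.1.1 + p.2.1) + (q.1.1 + q.2.1) by ring)
        (Subtype.ext (show (p.1.1 + q.1.1) * j - (p.2.1 + q.2.1) * i =
          (p.1.1 * j - p.2.1 * i) + (q.1.1 * j - q.2.1 * i) by ring))
      map_smul' := fun r p ↦ Prod.ext
        (show r * p.1.1 + r * p.2.1 = r * (p.1.1 + p.2.1) by ring)
        (Subtype.ext (show r * p.1.1 * j - r * p.2.1 * i = r * (p.1.1 * j - p.2.1 * i) by ring)) }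
  refine ⟨LinearEquiv.ofBijective f ⟨fun p q hpq ↦ ?_, fun q ↦ ?_⟩⟩
  · have h₁ : p.1.1 + p.2.1 = q.1.1 + q.2.1 := congrArg Prod.fst hpq
    have h₂ : p.1.1 * j - p.2.1 * i = q.1.1 * j - q.2.1 * i :=
      congrArg Subtype.val (congrArg Prod.snd hpq)
    refine Prod.ext (Subtype.ext ?_) (Subtype.ext ?_)
    · linear_combination i * h₁ + h₂ + (q.1.1 - p.1.1) * hij
    · linear_combination j * h₁ - h₂ + (q.2.1 - p.2.1) * hij
  · refine ⟨(⟨q.1 * i + q.2, add_mem (I.mul_mem_left _ hi) (mul_le_left q.2.2)⟩,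
      ⟨q.1 * j - q.2, sub_mem (J.mul_mem_left _ hj) (mul_le_right q.2.2)⟩), Prod.ext ?_
      (Subtype.ext ?_)⟩
    · change q.1 * i + q.2.1 + (q.1 * j - q.2.1) = q.1
      linear_combination q.1 * hij
    · change (q.1 * i + q.2.1) * j - (q.1 * j - q.2.1) * i = q.2.1
      linear_combination q.2.1 * hij

variable [IsDomain R]

theorem nonempty_linearEquiv_span_singleton_mul (I : Ideal R) {x : R} (hx : x ≠ 0) :
    Nonempty (I ≃ₗ[R] (span {x} * I : Ideal R)) := by
  have hinj : Function.Injective (LinearMap.mulLeft R x) := mul_right_injective₀ hx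
  refine ⟨(Submodule.equivMapOfInjective _ hinj I).trans (LinearEquiv.ofEq _ _ ?_)⟩
  ext y
  simp [mem_span_singleton_mul]

theorem nonempty_linearEquiv_of_span_singleton_mul_eq {I J : Ideal R} {x y : R} (hx : x ≠ 0)
    (hy : y ≠ 0) (h : span {x} * I = span {y} * J) : Nonempty (I ≃ₗ[R] J) := by
  obtain ⟨e⟩ := I.nonempty_linearEquiv_span_singleton_mul hx
  obtain ⟨e'⟩ := J.nonempty_linearEquiv_span_singleton_mul hy
  exact ⟨(e.trans (LinearEquiv.ofEq _ _ h)).trans e'.symm⟩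

theorem finrank_eq_one {I : Ideal R} (hI : I ≠ ⊥) : Module.finrank R I = 1 := by
  have h := Submodule.finrank_quotient_add_finrank I
  obtain ⟨x, hx, hx0⟩ := I.exists_mem_ne_zero_of_ne_bot hI
  have h0 : Module.finrank R (R ⧸ I) = 0 := by
    rw [Module.finrank_eq_zero_iff_isTorsion]
    intro y
    obtain ⟨y, rfl⟩ := Submodule.Quotient.mk_surjective I y
    refine ⟨⟨x, mem_nonZeroDivisors_of_ne_zero hx0⟩, ?_⟩
    change x • (Submodule.Quotient.mk y : R ⧸ I) = _
    rw [← Submodule.Quotient.mk_smul, Submodule.Quotient.mk_eq_zero]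
    exact I.mul_mem_right _ hx
  rw [h0, Module.finrank_self] at h
  omega

end Ideal

section Dedekind

variable {R : Type u} [CommRing R] [IsDedekindDomain R]

instance Module.Projective.of_finite_of_isTorsionFree (P : Type*) [AddCommGroup P] [Module R P]
    [Module.Finite R P] [Module.IsTorsionFree R P] : Module.Projective R P :=
  have := Module.finitePresentation_of_finite R P
  Module.Flat.projective_of_finitePresentation

/-- Moves `I` within its class to be coprime to `J`. Write `(x) = I I'` and pick `a` with `I'J + (a)
= I'`. Then `(a) = I'C`; cancelling `I'` gives `J + C = R`, and `xC = I I' C = aI`. -/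
theorem Ideal.exists_sup_eq_top_and_span_singleton_mul_eq {I J : Ideal R} (hI : I ≠ ⊥)
    (hJ : J ≠ ⊥) : ∃ (C : Ideal R) (x y : R), x ≠ 0 ∧ y ≠ 0 ∧ C ⊔ J = ⊤ ∧
      span {x} * C = span {y} * I := by
  by_cases hJt : J = ⊤
  · exact ⟨I, 1, 1, one_ne_zero, one_ne_zero, by simp [hJt], rfl⟩
  obtain ⟨x, hx, hx0⟩ := I.exists_mem_ne_zero_of_ne_bot hI
  obtain ⟨I', hI'⟩ : I ∣ span {x} := dvd_span_singleton.mpr hx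
  have hxb : (span {x} : Ideal R) ≠ ⊥ := by simpa using hx0
  have hI'0 : I' ≠ ⊥ := by
    rintro rfl
    exact hxb (by simp [hI'])
  obtain ⟨a, ha⟩ := IsDedekindDomain.exists_sup_span_eq (I := I' * J) (J := I') Ideal.mul_le_left
    (mul_ne_zero hI'0 hJ)
  obtain ⟨C, hC⟩ : I' ∣ span {a} := dvd_iff_le.mpr (ha ▸ le_sup_right)
  have hCJ : C ⊔ J = ⊤ := by
    rw [hC, ← mul_sup] at ha
    rw [sup_comm, ← one_eq_top]
    exact mul_left_cancel₀ hI'0 (by rw [ha, mul_one])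
  refine ⟨C, x, a, hx0, fun h0 ↦ hJt ?_, hCJ, ?_⟩
  · rw [← hCJ, right_eq_sup]
    have : C = ⊥ := (mul_eq_zero.mp (hC.symm.trans (by simp [h0]))).resolve_left hI'0
    simp [this]
  · rw [hI', hC]
    ring

theorem Ideal.nonempty_prod_linearEquiv {I J : Ideal R} (hI : I ≠ ⊥) (hJ : J ≠ ⊥) :
    Nonempty ((I × J) ≃ₗ[R] R × (I * J : Ideal R)) := by
  obtain ⟨C, x, y, hx, hy, hCJ, h⟩ := exists_sup_eq_top_and_span_singleton_mul_eq hI hJ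
  obtain ⟨e⟩ := nonempty_linearEquiv_of_span_singleton_mul_eq hx hy h
  obtain ⟨e'⟩ := nonempty_linearEquiv_of_span_singleton_mul_eq (I := C * J) (J := I * J) hx hy
    (by rw [← mul_assoc, h, mul_assoc])
  obtain ⟨e''⟩ := nonempty_prod_linearEquiv_of_sup_eq_top hCJ
  exact ⟨((e.symm.prodCongr (.refl R J)).trans e'').trans ((LinearEquiv.refl R R).prodCongr e')⟩

end Dedekind

/-- `P` is isomorphic to the direct sum of `a` copies of `R` and the ideal `I`. -/
def IsFreeProdIdeal (R : Type*) [CommRing R] (P : Type*) [AddCommGroup P] [Module R P]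
    (a : ℕ) (I : Ideal R) : Prop :=
  Nonempty (P ≃ₗ[R] (Fin a → R) × I)

/-! ### Modules of the form `R^a ⊕ I`: direct sums and existence. -/

namespace IsFreeProdIdeal

variable {R : Type*} [CommRing R] {P Q : Type*} [AddCommGroup P] [Module R P]
  [AddCommGroup Q] [Module R Q] {a b : ℕ} {I J : Ideal R}

theorem congr (h : IsFreeProdIdeal R P a I) (e : Q ≃ₗ[R] P) : IsFreeProdIdeal R Q a I :=
  h.map e.trans

theorem fun_prod (h : IsFreeProdIdeal R P a I) :
    IsFreeProdIdeal R ((Fin b → R) × P) (b + a) I :=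
  h.map fun e ↦ ((LinearEquiv.refl R (Fin b → R)).prodCongr e).trans <|
    (LinearEquiv.prodAssoc R (Fin b → R) (Fin a → R) I).symm.trans <|
      ((LinearEquiv.sumArrowLequivProdArrow (Fin b) (Fin a) R R).symm.trans
        (LinearEquiv.funCongrLeft R R finSumFinEquiv.symm)).prodCongr (.refl R I)

theorem nonempty_linearEquiv (h : IsFreeProdIdeal R P a I) (h' : IsFreeProdIdeal R Q a I) :
    Nonempty (P ≃ₗ[R] Q) := by
  obtain ⟨e⟩ := h
  obtain ⟨e'⟩ := h'
  exact ⟨e.trans e'.symm⟩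

variable [IsDedekindDomain R]

theorem prod_ideal (hI : I ≠ ⊥) (hJ : J ≠ ⊥) : IsFreeProdIdeal R (I × J) 1 (I * J) := by
  obtain ⟨e⟩ := Ideal.nonempty_prod_linearEquiv hI hJ
  exact ⟨e.trans ((LinearEquiv.funUnique (Fin 1) R R).symm.prodCongr (.refl _ _))⟩

theorem prod (hI : I ≠ ⊥) (hJ : J ≠ ⊥) (h : IsFreeProdIdeal R P a I)
    (h' : IsFreeProdIdeal R Q b J) : IsFreeProdIdeal R (P × Q) (a + (b + 1)) (I * J) := by
  obtain ⟨e⟩ := h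
  obtain ⟨e'⟩ := h'
  have h₁ : IsFreeProdIdeal R ((Fin a → R) × (Fin b → R) × I × J) (a + (b + 1)) (I * J) :=
    ((prod_ideal hI hJ).fun_prod).fun_prod
  exact h₁.congr <| (e.prodCongr e').trans <|
    (LinearEquiv.prodProdProdComm R _ _ _ _).trans (LinearEquiv.prodAssoc R _ _ _)

/-- The number of free summands is the rank minus one. The exponent is `t + 1` because the zero
module has no such form with a nonzero ideal. -/
theorem pi (hI : I ≠ ⊥) (h : IsFreeProdIdeal R P a I) :
    ∀ t : ℕ, IsFreeProdIdeal R (Fin (t + 1) → P) ((t + 1) * (a + 1) - 1) (I ^ (t + 1))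
  | 0 => by simpa using h.congr (LinearEquiv.funUnique (Fin 1) R P)
  | t + 1 => by
    have h₁ := h.prod hI (pow_ne_zero (t + 1) hI) (h.pi hI t)
    have h₂ := h₁.congr (Fin.consLinearEquiv R fun _ : Fin (t + 1 + 1) ↦ P).symm
    have : 0 < (t + 1) * (a + 1) := by positivity
    have hn : a + ((t + 1) * (a + 1) - 1 + 1) = (t + 1 + 1) * (a + 1) - 1 := by
      rw [add_mul (t + 1)]
      omega
    rw [← pow_succ', hn] at h₂
    exact h₂

end IsFreeProdIdeal

/-- `P` is projective, so some functional is nonzero. Its range is a nonzero ideal, hence projective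
of rank one, and splits off; the kernel has rank one less. -/
theorem exists_isFreeProdIdeal {R : Type*} [CommRing R] [IsDedekindDomain R] (a : ℕ) :
    ∀ (P : Type v) [AddCommGroup P] [Module R P] [Module.Finite R P] [Module.IsTorsionFree R P],
      Module.finrank R P = a + 1 → ∃ I : Ideal R, I ≠ ⊥ ∧ IsFreeProdIdeal R P a I := by
  induction a with
  | zero => ?_
  | succ a ih => ?_
  all_goals
    intro P _ _ _ _ hP
    have : Nontrivial P := Module.nontrivial_of_finrank_pos (R := R) (by omega)
    obtain ⟨x, hx⟩ := exists_ne (0 : P)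
    obtain ⟨φ, hφ⟩ : ∃ φ : Module.Dual R P, φ x ≠ 0 := by
      by_contra! h
      exact hx ((Module.forall_dual_apply_eq_zero_iff R x).mp h)
    have hI : φ.range ≠ ⊥ := fun h ↦ hφ (by simpa [h] using φ.mem_range_self x)
    have hrank := Submodule.finrank_quotient_add_finrank φ.ker
    rw [φ.quotKerEquivRange.finrank_eq, Ideal.finrank_eq_one hI, hP] at hrank
    obtain ⟨e⟩ := φ.rangeRestrict.nonempty_linearEquiv_ker_prod_of_surjective
      φ.surjective_rangeRestrict
    rw [φ.ker_rangeRestrict] at e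
  · have h := (Module.finrank_eq_zero_iff_isTorsion (R := R) (M := φ.ker)).mp (by omega)
    have hker : φ.ker = ⊥ := by
      rw [Submodule.eq_bot_iff]
      intro y hy
      obtain ⟨r, hr⟩ := @h ⟨y, hy⟩
      exact (smul_eq_zero.mp (congrArg Subtype.val hr : (r : R) • y = 0)).resolve_left
        (nonZeroDivisors.coe_ne_zero r)
    exact ⟨φ.range, hI, ⟨(LinearEquiv.ofInjective φ (LinearMap.ker_eq_bot.mp hker)).trans
      LinearEquiv.uniqueProd.symm⟩⟩
  · obtain ⟨J, hJ, e'⟩ := ih φ.ker (by omega)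
    obtain ⟨e'⟩ := e'
    refine ⟨J * φ.range, mul_ne_zero hJ hI, ?_⟩
    refine ((IsFreeProdIdeal.prod_ideal hJ hI).fun_prod (b := a)).congr ?_
    exact e.trans ((e'.prodCongr (.refl R _)).trans (LinearEquiv.prodAssoc R _ _ _))

/-! ### Uniqueness of the ideal class, by determinants. -/

namespace IsFreeProdIdeal

open Matrix

variable {R : Type*} [CommRing R] {a : ℕ} {I J : Ideal R}

/-- The coordinates of an element of `R ^ a ⊕ I` in `R ^ (a + 1)`. -/
def coords (I : Ideal R) (p : (Fin a → R) × I) : Fin a ⊕ Unit → R :=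
  Sum.elim p.1 fun _ ↦ p.2

/-- The matrix of the restriction of `φ : R ^ a ⊕ I → R ^ a ⊕ J` to the free submodule
`R ^ a ⊕ R d`, where `d ∈ I`. -/
def restrictMatrix (φ : ((Fin a → R) × I) →ₗ[R] (Fin a → R) × J) (d : I) :
    Matrix (Fin a ⊕ Unit) (Fin a ⊕ Unit) R :=
  Matrix.of fun i j ↦ coords J
    (φ (Sum.elim (fun j ↦ (Pi.single j 1, 0)) (fun _ ↦ (0, d)) j)) i

theorem coords_add (p q : (Fin a → R) × I) : coords I (p + q) = coords I p + coords I q := by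
  ext (i | i) <;> simp [coords]

theorem coords_smul (r : R) (p : (Fin a → R) × I) : coords I (r • p) = r • coords I p := by
  ext (i | i) <;> simp [coords]

/-- `coords` as a linear map. -/
def coordsₗ (I : Ideal R) : ((Fin a → R) × I) →ₗ[R] Fin a ⊕ Unit → R where
  toFun := coords I
  map_add' := coords_add
  map_smul' := coords_smul

theorem restrictMatrix_mulVec (φ : ((Fin a → R) × I) →ₗ[R] (Fin a → R) × J) (d : I)
    (v : Fin a ⊕ Unit → R) :
    restrictMatrix φ d *ᵥ v = coords J (φ (v ∘ Sum.inl, v (Sum.inr ()) • d)) := by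
  have h : ((v ∘ Sum.inl, v (Sum.inr ()) • d) : (Fin a → R) × I) =
      ∑ j, v j • Sum.elim (fun j ↦ (Pi.single j 1, 0)) (fun _ ↦ (0, d)) j := by
    rw [Fintype.sum_sum_type]
    refine Prod.ext ?_ ?_
    · ext i
      simp [Prod.fst_sum, Finset.sum_apply, Pi.single_apply]
    · simp [Prod.snd_sum]
  rw [h, map_sum]
  change _ = coordsₗ J _
  rw [map_sum]
  ext i
  rw [Finset.sum_apply, mulVec, dotProduct]
  refine Finset.sum_congr rfl fun j _ ↦ ?_
  rw [map_smul, map_smul, Pi.smul_apply, smul_eq_mul, mul_comm]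
  rfl

/-- Only the last column depends on `d`, and `x φ(0, d) = d φ(0, x)`. So `det / d` is independent of
`d`: it is the determinant of `φ` over the fraction field. -/
theorem mul_det_restrictMatrix (φ : ((Fin a → R) × I) →ₗ[R] (Fin a → R) × J) (d x : I) :
    (x : R) * (restrictMatrix φ d).det = d * (restrictMatrix φ x).det := by
  have key : ∀ y z : I, (y : R) * (restrictMatrix φ z).det =
      ((restrictMatrix φ z).updateCol (Sum.inr ())
        (coords J ((y : R) • φ (0, z)))).det := by
    intro y z
    rw [coords_smul, det_updateCol_smul]
    congr 1
    rw [show coords J (φ (0, z)) = (restrictMatrix φ z).col (Sum.inr ()) from rfl]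
    exact (congrArg det (updateCol_eq_self _ _)).symm
  rw [key, key]
  congr 1
  ext i (j | j)
  · simp [restrictMatrix]
  · have : (x : R) • φ (0, d) = (d : R) • φ (0, x) := by
      rw [← map_smul, ← map_smul]
      congr 1
      refine Prod.ext (by simp) (Subtype.ext ?_)
      simp [mul_comm]
    simp [this]

theorem det_restrictMatrix_mem (φ : ((Fin a → R) × I) →ₗ[R] (Fin a → R) × J) (x : I) :
    (restrictMatrix φ x).det ∈ J := by
  rw [det_eq_sum_mul_adjugate_row _ (Sum.inr ())]
  exact sum_mem fun j _ ↦ J.mul_mem_right _ (Subtype.prop _)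

theorem det_restrictMatrix_mul_det [IsDomain R]
    (e : ((Fin a → R) × I) ≃ₗ[R] (Fin a → R) × J) {d : I} (hd : (d : R) ≠ 0) (c : J) :
    (restrictMatrix e.toLinearMap d).det * (restrictMatrix e.symm.toLinearMap c).det = d * c := by
  -- The coordinates of `e.symm` lie in `R^a ⊕ I`, not in `R^a ⊕ R d`. The middle factor scales by
  -- `d` to repair this, at the cost of `d ^ a`, which is cancelled at the end.
  have hmul : restrictMatrix e.toLinearMap d *
      diagonal (Sum.elim (fun _ : Fin a ↦ (d : R)) fun _ : Unit ↦ 1) *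
        restrictMatrix e.symm.toLinearMap c =
      (d : R) • diagonal (Sum.elim (fun _ : Fin a ↦ 1) fun _ : Unit ↦ (c : R)) := by
    refine ext_of_mulVec_single fun k ↦ ?_
    generalize (Pi.single k 1 : Fin a ⊕ Unit → R) = w
    rw [← mulVec_mulVec, ← mulVec_mulVec, restrictMatrix_mulVec e.symm.toLinearMap]
    set p := e.symm.toLinearMap (w ∘ Sum.inl, w (Sum.inr ()) • c) with hp
    have hp' : e p = (w ∘ Sum.inl, w (Sum.inr ()) • c) := by simp [hp]
    rw [restrictMatrix_mulVec]
    have : ((diagonal (Sum.elim (fun _ : Fin a ↦ (d : R)) fun _ : Unit ↦ 1) *ᵥ coords I p) ∘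
        Sum.inl, (diagonal (Sum.elim (fun _ : Fin a ↦ (d : R)) fun _ : Unit ↦ 1) *ᵥ
          coords I p) (Sum.inr ()) • d) = (d : R) • p := by
      refine Prod.ext ?_ (Subtype.ext ?_)
      · ext i
        simp [mulVec_diagonal, coords]
      · simp [mulVec_diagonal, coords, mul_comm]
    rw [this, map_smul, LinearEquiv.coe_coe, hp', coords_smul, smul_mulVec]
    congr 1
    ext (i | i) <;> simp [mulVec_diagonal, coords, mul_comm]
  have hdet := congrArg det hmul
  rw [det_mul, det_mul, det_smul, det_diagonal, det_diagonal] at hdet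
  simp only [Fintype.prod_sum_type, Sum.elim_inl, Sum.elim_inr, Finset.prod_const,
    Finset.card_univ, Fintype.card_fin, Finset.univ_unique, Finset.card_singleton, pow_one,
    mul_one, one_pow, one_mul, Fintype.card_sum, Fintype.card_unit] at hdet
  refine mul_left_cancel₀ (pow_ne_zero a hd) ?_
  linear_combination hdet

/-- The determinant `α` of an isomorphism restricted to `R^a ⊕ R d` satisfies `αI = dJ`. One
inclusion uses the determinants for `e`, the other those for its inverse. -/
theorem mk0_eq_mk0 [IsDedekindDomain R] {P : Type*} [AddCommGroup P] [Module R P]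
    {I J : (Ideal R)⁰} (h : IsFreeProdIdeal R P a (I : Ideal R))
    (h' : IsFreeProdIdeal R P a (J : Ideal R)) : ClassGroup.mk0 I = ClassGroup.mk0 J := by
  obtain ⟨e₁⟩ := h
  obtain ⟨e₂⟩ := h'
  let e := e₁.symm.trans e₂
  obtain ⟨d, hdI, hd⟩ := (I : Ideal R).exists_mem_ne_zero_of_ne_bot (nonZeroDivisors.coe_ne_zero I)
  obtain ⟨c, hcJ, hc⟩ := (J : Ideal R).exists_mem_ne_zero_of_ne_bot (nonZeroDivisors.coe_ne_zero J)
  lift d to (I : Ideal R) using hdI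
  lift c to (J : Ideal R) using hcJ
  have hdc := det_restrictMatrix_mul_det e hd c
  set α := (restrictMatrix e.toLinearMap d).det with hα
  set β := (restrictMatrix e.symm.toLinearMap c).det with hβ
  have hα0 : α ≠ 0 := fun h0 ↦ mul_ne_zero hd hc (by rw [← hdc, h0, zero_mul])
  refine ClassGroup.mk0_eq_mk0_iff.mpr ⟨α, d, hα0, hd, le_antisymm ?_ ?_⟩
  · rw [Ideal.span_singleton_mul_le_span_singleton_mul]
    intro x hx
    exact ⟨_, det_restrictMatrix_mem e.toLinearMap ⟨x, hx⟩, by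
      rw [← mul_det_restrictMatrix e.toLinearMap d ⟨x, hx⟩, mul_comm]⟩
  · rw [Ideal.span_singleton_mul_le_span_singleton_mul]
    intro y hy
    refine ⟨_, det_restrictMatrix_mem e.symm.toLinearMap ⟨y, hy⟩, mul_left_cancel₀ hc ?_⟩
    have := mul_det_restrictMatrix e.symm.toLinearMap c ⟨y, hy⟩
    simp only [← hβ] at this
    linear_combination α * this - y * hdc

end IsFreeProdIdeal

/-! ### Splitting capacity as a supremum. -/

section Capacity

variable {A : Type*} [Ring A] {M : Type*} [AddCommGroup M] [Module A M]
  {N : Type*} [AddCommGroup N] [Module A N]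

theorem HasSplitSurjection.mono {s t : ℕ} (h : HasSplitSurjection A M N t) (hst : s ≤ t) :
    HasSplitSurjection A M N s := by
  obtain ⟨f, g, hfg⟩ := h
  let j : (Fin s → N) →ₗ[A] (Fin t → N) :=
    LinearMap.pi fun i ↦ if hi : i.1 < s then LinearMap.proj ⟨i, hi⟩ else 0
  refine ⟨LinearMap.funLeft A N (Fin.castLE hst) ∘ₗ f, g ∘ₗ j, LinearMap.ext fun x ↦ ?_⟩
  have := LinearMap.congr_fun hfg (j x)
  simp only [LinearMap.comp_apply, LinearMap.id_apply] at this ⊢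
  rw [this]
  ext i
  simp [j, LinearMap.funLeft_apply]

theorem le_splittingCapacity_iff {t : ℕ} :
    (t : ℕ∞) ≤ splittingCapacity A M N ↔ HasSplitSurjection A M N t := by
  refine ⟨fun h ↦ ?_, fun h ↦ le_sSup ⟨t, rfl, h⟩⟩
  cases t with
  | zero => exact ⟨0, 0, Subsingleton.elim _ _⟩
  | succ t =>
    -- The supremum may be infinite and not attained, so a strict bound is used to find a member
    -- above `t`.
    have hlt : (t : ℕ∞) < sSup _ := lt_of_lt_of_le (by exact_mod_cast t.lt_succ_self) h
    obtain ⟨_, ⟨s, rfl, hs⟩, hts⟩ := lt_sSup_iff.mp hlt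
    exact hs.mono (by exact_mod_cast hts)

end Capacity

/-! ### Passing to localizations and clearing denominators. -/

section Localization

variable {R : Type*} [CommRing R] {M : Type*} [AddCommGroup M] [Module R M]
  {N : Type*} [AddCommGroup N] [Module R N]

theorem HasSplitSurjection.localizedModule {t : ℕ} (h : HasSplitSurjection R M N t)
    (S : Submonoid R) :
    HasSplitSurjection (Localization S) (LocalizedModule S M) (LocalizedModule S N) t := by
  obtain ⟨f, g, hfg⟩ := h
  let ι : (Fin t → N) →ₗ[R] (Fin t → LocalizedModule S N) :=
    LinearMap.pi fun i ↦ LocalizedModule.mkLinearMap S N ∘ₗ LinearMap.proj i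
  refine ⟨IsLocalizedModule.mapExtendScalars S (LocalizedModule.mkLinearMap S M) ι _ f,
    IsLocalizedModule.mapExtendScalars S ι (LocalizedModule.mkLinearMap S M) _ g, ?_⟩
  apply LinearMap.restrictScalars_injective R
  change IsLocalizedModule.map S (LocalizedModule.mkLinearMap S M) ι f ∘ₗ
    IsLocalizedModule.map S ι (LocalizedModule.mkLinearMap S M) g = LinearMap.id
  rw [← IsLocalizedModule.map_comp', hfg, IsLocalizedModule.map_id]

theorem exists_comp_eq_smul_id_of_hasSplitSurjection_localizedModule
    [Module.FinitePresentation R M] [Module.FinitePresentation R N] {S : Submonoid R} {t : ℕ}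
    (h : HasSplitSurjection (Localization S) (LocalizedModule S M) (LocalizedModule S N) t) :
    ∃ (f : M →ₗ[R] (Fin t → N)) (g : (Fin t → N) →ₗ[R] M), ∃ s ∈ S,
      f ∘ₗ g = s • LinearMap.id := by
  obtain ⟨f', g', hfg⟩ := h
  let ι : (Fin t → N) →ₗ[R] (Fin t → LocalizedModule S N) :=
    LinearMap.pi fun i ↦ LocalizedModule.mkLinearMap S N ∘ₗ LinearMap.proj i
  let κ := LocalizedModule.mkLinearMap S M
  obtain ⟨f, s, hf⟩ := Module.FinitePresentation.exists_lift_of_isLocalizedModule S ι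
    (f'.restrictScalars R ∘ₗ κ)
  obtain ⟨g, s', hg⟩ := Module.FinitePresentation.exists_lift_of_isLocalizedModule S κ
    (g'.restrictScalars R ∘ₗ ι)
  -- `f ∘ g` and `s s'` agree only after localizing; `s''` makes them agree over `R`.
  obtain ⟨s'', hs''⟩ := Module.Finite.exists_smul_of_comp_eq_of_isLocalizedModule S ι
    (f ∘ₗ g) ((s * s') • LinearMap.id) <| by
      refine LinearMap.ext fun x ↦ ?_
      have h₁ : ∀ y, ι (f y) = s • f' (κ y) := LinearMap.congr_fun hf
      have h₂ : ∀ y, κ (g y) = s' • g' (ι y) := LinearMap.congr_fun hg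
      have h₃ : ∀ y, f' (g' y) = y := LinearMap.congr_fun hfg
      have h₄ : f' (s' • g' (ι x)) = s' • f' (g' (ι x)) :=
        (f'.restrictScalars R).map_smul (s' : R) _
      change ι (f (g x)) = ι ((s * s') • x)
      rw [h₁, h₂, h₄, h₃, ← mul_smul]
      exact (ι.map_smul ((s * s' : S) : R) x).symm
  refine ⟨(s'' : R) • f, g, (s'' * (s * s') : S), (s'' * (s * s')).2, ?_⟩
  rw [LinearMap.smul_comp]
  refine hs''.trans ?_
  rw [smul_smul]
  rfl

end Localization

/-! ### Gluing local splittings. -/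

section Gluing

variable {R : Type*} [CommRing R] [IsDedekindDomain R] {P Q : Type*} [AddCommGroup P] [Module R P]
  [AddCommGroup Q] [Module R Q]

/-- Take `e p` to be `1` modulo the `p`-part of `I` and `0` modulo the other parts. In `(∑ e p • f
p) ∘ (∑ e p • g p)` the cross terms have coefficients in `I`, which kills `Q`. What remains is
multiplication by `z = ∑ e p ^ 2 * s p`, a unit modulo `I`. -/
theorem LinearMap.exists_comp_eq_id_of_local {I : Ideal R} (hI : I ≠ ⊥)
    (hIQ : ∀ r ∈ I, ∀ x : Q, r • x = 0)
    (h : ∀ p : Ideal R, p.IsPrime → I ≤ p → ∃ (f : P →ₗ[R] Q) (g : Q →ₗ[R] P), ∃ s ∉ p,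
      f ∘ₗ g = s • LinearMap.id) :
    ∃ (f : P →ₗ[R] Q) (g : Q →ₗ[R] P), f ∘ₗ g = LinearMap.id := by
  classical
  let F := UniqueFactorizationMonoid.normalizedFactors I
  have hF : ∀ {p : Ideal R}, p ∈ F.toFinset ↔ p.IsPrime ∧ I ≤ p := by
    intro p
    rw [Multiset.mem_toFinset, Ideal.mem_normalizedFactors_iff hI]
  have hprime : ∀ p ∈ F.toFinset, Prime p := fun p hp ↦
    Ideal.prime_of_isPrime (ne_bot_of_le_ne_bot hI (hF.mp hp).2) (hF.mp hp).1
  have hIinf : F.toFinset.inf (fun p ↦ p ^ F.count p) = I := by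
    rw [IsDedekindDomain.inf_pow_eq_prod_of_prime _ _ _ hprime fun _ _ _ _ h ↦ h,
      ← Finset.prod_multiset_count, Ideal.prod_normalizedFactors_eq_self hI]
  have hmem : ∀ {r : R}, r ∈ I ↔ ∀ p ∈ F.toFinset, r ∈ p ^ F.count p := by
    intro r
    rw [← hIinf, Submodule.mem_finsetInf]
  have he : ∀ p : Ideal R, ∃ e : R, ∀ q ∈ F.toFinset,
      e - (if q = p then 1 else 0) ∈ q ^ F.count q := fun p ↦
    IsDedekindDomain.exists_forall_sub_mem_ideal (fun q ↦ q) F.count hprime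
      (fun _ _ _ _ h ↦ h) (fun q ↦ if q.1 = p then 1 else 0)
  choose e he using he
  have h' : ∀ p : Ideal R, ∃ (f : P →ₗ[R] Q) (g : Q →ₗ[R] P) (s : R), p ∈ F.toFinset →
      s ∉ p ∧ f ∘ₗ g = s • LinearMap.id := by
    intro p
    by_cases hp : p ∈ F.toFinset
    · obtain ⟨f, g, s, hs, hfg⟩ := h p (hF.mp hp).1 (hF.mp hp).2
      exact ⟨f, g, s, fun _ ↦ ⟨hs, hfg⟩⟩
    · exact ⟨0, 0, 0, fun hp' ↦ absurd hp' hp⟩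
  choose f g s hs using h'
  have hemem : ∀ {p q : Ideal R}, q ∈ F.toFinset → q ≠ p → e p ∈ q ^ F.count q := by
    intro p q hq hqp
    simpa [hqp] using he p q hq
  have hee : ∀ {p q : Ideal R}, p ≠ q → e p * e q ∈ I := by
    intro p q hpq
    rw [hmem]
    intro r hr
    by_cases hrp : r = p
    · exact Ideal.mul_mem_left _ _ (hemem hr (hrp ▸ hpq))
    · exact Ideal.mul_mem_right _ _ (hemem hr hrp)
  set z : R := ∑ p ∈ F.toFinset, e p * e p * s p with hz
  have hzI : Ideal.span {z} ⊔ I = ⊤ := by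
    by_contra hne
    obtain ⟨m, hm, hle⟩ := Ideal.exists_le_maximal _ hne
    have hmF : m ∈ F.toFinset := hF.mpr ⟨hm.isPrime, le_sup_right.trans hle⟩
    have hpow : m ^ F.count m ≤ m := Ideal.pow_le_self
      (Multiset.count_ne_zero.mpr (Multiset.mem_toFinset.mp hmF))
    have hzm : z ∈ m := hle (Ideal.mem_sup_left (Ideal.mem_span_singleton_self z))
    -- Modulo `m` only the term of `m` itself survives, and none of its factors lies in `m`.
    rw [hz, ← Finset.add_sum_erase _ _ hmF, Ideal.add_mem_iff_left] at hzm
    · have hem : e m ∉ m := by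
        intro hem
        refine hm.ne_top ((Ideal.eq_top_iff_one m).mpr ?_)
        simpa using sub_mem hem (hpow (he m m hmF))
      rcases hm.isPrime.mem_or_mem hzm with h₁ | h₁
      · exact (hm.isPrime.mem_or_mem h₁).elim hem hem
      · exact (hs m hmF).1 h₁
    · refine sum_mem fun p hp ↦ Ideal.mul_mem_right _ _ (Ideal.mul_mem_right _ _ (hpow ?_))
      exact hemem hmF (Finset.ne_of_mem_erase hp).symm
  obtain ⟨z', hz', y, hy, hzy⟩ := Submodule.mem_sup.mp (hzI ▸ Submodule.mem_top : (1 : R) ∈ _)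
  obtain ⟨v, rfl⟩ := Ideal.mem_span_singleton'.mp hz'
  refine ⟨∑ p ∈ F.toFinset, e p • f p, v • ∑ p ∈ F.toFinset, e p • g p, LinearMap.ext fun x ↦ ?_⟩
  have hsum : (∑ p ∈ F.toFinset, e p • f p) ((∑ p ∈ F.toFinset, e p • g p) x) = z • x := by
    simp only [LinearMap.sum_apply, LinearMap.smul_apply, map_sum, map_smul, Finset.smul_sum,
      hz, Finset.sum_smul, smul_smul]
    refine Finset.sum_congr rfl fun p hp ↦ ?_
    rw [Finset.sum_eq_single_of_mem p hp]
    · have : f p (g p x) = s p • x := LinearMap.congr_fun (hs p hp).2 x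
      rw [this, smul_smul]
    · exact fun q _ hqp ↦ hIQ _ (hee (Ne.symm hqp)) _
  calc _ = v • (∑ p ∈ F.toFinset, e p • f p) ((∑ p ∈ F.toFinset, e p • g p) x) := by
        rw [LinearMap.comp_apply, LinearMap.smul_apply, map_smul]
    _ = (v * z) • x + y • x := by rw [hsum, smul_smul, hIQ y hy, add_zero]
    _ = x := by rw [← add_smul, hzy, one_smul]

end Gluing

/-! ### Operations on split surjections and restriction to torsion. -/

namespace HasSplitSurjection

section Basic

variable {A : Type*} [Ring A] {M M' N N' K : Type*} [AddCommGroup M] [Module A M]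
  [AddCommGroup M'] [Module A M'] [AddCommGroup N] [Module A N] [AddCommGroup N'] [Module A N']
  [AddCommGroup K] [Module A K] {t : ℕ}

theorem congr (h : HasSplitSurjection A M N t) (e : M ≃ₗ[A] M') (e' : N ≃ₗ[A] N') :
    HasSplitSurjection A M' N' t := by
  obtain ⟨f, g, hfg⟩ := h
  let E : (Fin t → N) ≃ₗ[A] (Fin t → N') := LinearEquiv.piCongrRight fun _ ↦ e'
  refine ⟨E.toLinearMap ∘ₗ f ∘ₗ e.symm.toLinearMap, e.toLinearMap ∘ₗ g ∘ₗ E.symm.toLinearMap,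
    LinearMap.ext fun x ↦ ?_⟩
  have := LinearMap.congr_fun hfg (E.symm x)
  simp only [LinearMap.comp_apply, LinearMap.id_apply] at this
  simp [this]

theorem prod (h : HasSplitSurjection A M N t) (h' : HasSplitSurjection A M' N' t) :
    HasSplitSurjection A (M × M') (N × N') t := by
  obtain ⟨f, g, hfg⟩ := h
  obtain ⟨f', g', hfg'⟩ := h'
  refine ⟨LinearMap.pi fun i ↦ (LinearMap.proj i ∘ₗ f).prodMap (LinearMap.proj i ∘ₗ f'),
    (g.prodMap g') ∘ₗ ((LinearMap.fst A N N').compLeft (Fin t)).prod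
      ((LinearMap.snd A N N').compLeft (Fin t)), LinearMap.ext fun x ↦ funext fun i ↦
        Prod.ext ?_ ?_⟩
  · exact congrFun (LinearMap.congr_fun hfg fun i ↦ (x i).1) i
  · exact congrFun (LinearMap.congr_fun hfg' fun i ↦ (x i).2) i

theorem of_linearEquiv_prod (e : M ≃ₗ[A] (Fin t → N) × K) : HasSplitSurjection A M N t :=
  ⟨LinearMap.fst A _ _ ∘ₗ e.toLinearMap, e.symm.toLinearMap ∘ₗ LinearMap.inl A _ _,
    LinearMap.ext fun x ↦ by simp⟩

theorem exists_surjective (h : HasSplitSurjection A M N t) :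
    ∃ f : M →ₗ[A] (Fin t → N), Function.Surjective f := by
  obtain ⟨f, g, hfg⟩ := h
  exact ⟨f, fun x ↦ ⟨g x, LinearMap.congr_fun hfg x⟩⟩

theorem of_linearEquiv (e : M ≃ₗ[A] Fin t → N) : HasSplitSurjection A M N t :=
  ⟨e.toLinearMap, e.symm.toLinearMap, LinearMap.ext fun x ↦ by simp⟩

theorem of_subsingleton [Subsingleton N] : HasSplitSurjection A M N t :=
  ⟨0, 0, Subsingleton.elim _ _⟩

end Basic

section Torsion

variable {R : Type*} [CommRing R] {M : Type*} [AddCommGroup M] [Module R M]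
  {N : Type*} [AddCommGroup N] [Module R N] {t : ℕ}

theorem _root_.LinearMap.torsion_le_comap (f : M →ₗ[R] N) :
    Submodule.torsion R M ≤ (Submodule.torsion R N).comap f := by
  rintro x ⟨a, ha⟩
  exact ⟨a, by rw [Submonoid.smul_def, ← map_smul, ← Submonoid.smul_def, ha, map_zero]⟩

theorem _root_.Submodule.mem_torsion_of_forall_apply [IsDomain R] {x : Fin t → N}
    (hx : ∀ i, x i ∈ Submodule.torsion R N) : x ∈ Submodule.torsion R (Fin t → N) := by
  choose a ha using hx
  refine ⟨∏ i, a i, funext fun i ↦ ?_⟩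
  rw [Pi.smul_apply, ← Finset.prod_erase_mul _ _ (Finset.mem_univ i), mul_smul, ha, smul_zero,
    Pi.zero_apply]

theorem _root_.LinearMap.exists_torsion_comp_eq_smul_id [IsDomain R] {f : M →ₗ[R] (Fin t → N)}
    {g : (Fin t → N) →ₗ[R] M} {s : R} (h : f ∘ₗ g = s • LinearMap.id) :
    ∃ (f' : Submodule.torsion R M →ₗ[R] (Fin t → Submodule.torsion R N))
      (g' : (Fin t → Submodule.torsion R N) →ₗ[R] Submodule.torsion R M),
      f' ∘ₗ g' = s • LinearMap.id := by
  refine ⟨LinearMap.pi fun i ↦ (LinearMap.proj i ∘ₗ f).restrict (LinearMap.torsion_le_comap _),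
    (g ∘ₗ (Submodule.torsion R N).subtype.compLeft (Fin t)).codRestrict _ fun x ↦
      g.torsion_le_comap (Submodule.mem_torsion_of_forall_apply fun i ↦ (x i).2),
    LinearMap.ext fun x ↦ funext fun i ↦ Subtype.ext ?_⟩
  exact congrFun (LinearMap.congr_fun h fun i ↦ (x i : N)) i

theorem torsion [IsDomain R] (h : HasSplitSurjection R M N t) :
    HasSplitSurjection R (Submodule.torsion R M) (Submodule.torsion R N) t := by
  obtain ⟨f, g, hfg⟩ := h
  obtain ⟨f', g', hfg'⟩ := LinearMap.exists_torsion_comp_eq_smul_id (s := 1)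
    (hfg.trans (one_smul _ _).symm)
  exact ⟨f', g', hfg'.trans (one_smul _ _)⟩

end Torsion

end HasSplitSurjection

/-! ### Additivity of rank. -/

section Rank

variable {R : Type*} [CommRing R] [IsDomain R]

theorem Module.finrank_prod_of_finite (P Q : Type*) [AddCommGroup P] [Module R P]
    [Module.Finite R P] [AddCommGroup Q] [Module R Q] [Module.Finite R Q] :
    Module.finrank R (P × Q) = Module.finrank R P + Module.finrank R Q := by
  have h := Submodule.finrank_quotient_add_finrank (LinearMap.fst R P Q).ker
  rw [((LinearMap.fst R P Q).quotKerEquivOfSurjective LinearMap.fst_surjective).finrank_eq,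
    LinearMap.ker_fst,
    ← (LinearEquiv.ofInjective (LinearMap.inr R P Q) LinearMap.inr_injective).finrank_eq] at h
  exact h.symm

theorem Module.finrank_pi_const (P : Type*) [AddCommGroup P] [Module R P]
    [Module.Finite R P] : ∀ t : ℕ, Module.finrank R (Fin t → P) = t * Module.finrank R P
  | 0 => by rw [Module.finrank_zero_of_subsingleton, zero_mul]
  | t + 1 => by
    rw [← (Fin.consLinearEquiv R fun _ : Fin (t + 1) ↦ P).finrank_eq,
      Module.finrank_prod_of_finite, Module.finrank_pi_const P t]
    ring

end Rank

/-! ### The torsion and torsion-free halves of the criterion. -/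

section Dedekind

variable {R : Type*} [CommRing R] [IsDedekindDomain R]

theorem Submodule.nonempty_linearEquiv_torsion_prod (M : Type*) [AddCommGroup M] [Module R M]
    [Module.Finite R M] :
    Nonempty (M ≃ₗ[R] torsion R M × (M ⧸ torsion R M)) := by
  have := (torsion R M).mkQ.nonempty_linearEquiv_ker_prod_of_surjective (mkQ_surjective _)
  rwa [ker_mkQ] at this

variable {M : Type*} [AddCommGroup M] [Module R M] [Module.Finite R M]
  {N : Type*} [AddCommGroup N] [Module R N] [Module.Finite R N] {t : ℕ}

/-- Nonzero primes are maximal, so a prime above the nonzero annihilator is minimal above it, hence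
associated. -/
theorem mem_associatedPrimes_of_annihilator_torsion_le {p : Ideal R} [p.IsPrime]
    (hp : Module.annihilator R (Submodule.torsion R N) ≤ p)
    (h0 : Module.annihilator R (Submodule.torsion R N) ≠ ⊥) :
    p ∈ associatedPrimes R N \ {⊥} := by
  refine ⟨associatedPrimes.subset_of_injective (Submodule.torsion R N).injective_subtype ?_,
    ne_bot_of_le_ne_bot h0 hp⟩
  apply Module.associatedPrimes.minimalPrimes_annihilator_subset_associatedPrimes
  refine ⟨⟨inferInstance, hp⟩, fun q hq hqp ↦ ?_⟩
  have : q.IsPrime := hq.1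
  have hq' := Ideal.IsPrime.isMaximal this (ne_bot_of_le_ne_bot h0 hq.2)
  exact (hq'.eq_of_le Ideal.IsPrime.ne_top' hqp).ge

theorem hasSplitSurjection_torsion_of_localized
    (h : ∀ (p : Ideal R) [p.IsPrime], p ∈ associatedPrimes R N \ {⊥} →
      HasSplitSurjection (Localization.AtPrime p) (LocalizedModule.AtPrime p M)
        (LocalizedModule.AtPrime p N) t) :
    HasSplitSurjection R (Submodule.torsion R M) (Submodule.torsion R N) t := by
  have h0 : Module.annihilator R (Submodule.torsion R N) ≠ ⊥ := by
    obtain ⟨r, hr, hr0⟩ := Submodule.annihilator_top_inter_nonZeroDivisors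
      (Submodule.torsion_isTorsion (R := R) (M := N))
    rw [SetLike.mem_coe, Submodule.annihilator_top] at hr
    exact (Submodule.ne_bot_iff _).mpr ⟨r, hr, nonZeroDivisors.ne_zero hr0⟩
  have := Module.finitePresentation_of_finite R M
  have := Module.finitePresentation_of_finite R N
  refine LinearMap.exists_comp_eq_id_of_local h0
    (fun r hr x ↦ funext fun i ↦ Module.mem_annihilator.mp hr (x i)) fun p hp hle ↦ ?_
  obtain ⟨f, g, s, hs, hfg⟩ := exists_comp_eq_smul_id_of_hasSplitSurjection_localizedModule
    (h p (mem_associatedPrimes_of_annihilator_torsion_le hle h0))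
  obtain ⟨f', g', hfg'⟩ := LinearMap.exists_torsion_comp_eq_smul_id hfg
  exact ⟨f', g', s, hs, hfg'⟩

theorem hasSplitSurjection_of_torsion_of_quotient
    (h : HasSplitSurjection R (Submodule.torsion R M) (Submodule.torsion R N) t)
    (h' : HasSplitSurjection R (M ⧸ Submodule.torsion R M) (N ⧸ Submodule.torsion R N) t) :
    HasSplitSurjection R M N t := by
  obtain ⟨e⟩ := Submodule.nonempty_linearEquiv_torsion_prod (R := R) M
  obtain ⟨e'⟩ := Submodule.nonempty_linearEquiv_torsion_prod (R := R) N
  exact (h.prod h').congr e.symm e'.symm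

theorem exists_isFreeProdIdeal_quotient_torsion (h : 0 < Module.finrank R M) :
    ∃ I : (Ideal R)⁰, IsFreeProdIdeal R (M ⧸ Submodule.torsion R M) (Module.finrank R M - 1)
      (I : Ideal R) := by
  obtain ⟨I, hI, hMI⟩ := exists_isFreeProdIdeal (R := R) (Module.finrank R M - 1)
    (M ⧸ Submodule.torsion R M) (by rw [finrank_quotient_eq_of_le_torsion le_rfl]; omega)
  exact ⟨⟨I, mem_nonZeroDivisors_of_ne_zero hI⟩, hMI⟩

omit [Module.Finite R M] in
theorem steinitzClass_eq {I : (Ideal R)⁰} (h : IsFreeProdIdeal R (M ⧸ Submodule.torsion R M)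
    (Module.finrank R M - 1) (I : Ideal R)) : steinitzClass R M = ClassGroup.mk0 I := by
  have hex : ∃ I : (Ideal R)⁰, IsSteinitzIdeal R M (I : Ideal R) := ⟨I, h⟩
  rw [steinitzClass, dif_pos hex]
  exact IsFreeProdIdeal.mk0_eq_mk0 (P := M ⧸ Submodule.torsion R M) hex.choose_spec h

omit [Module.Finite R N] in
theorem isFreeProdIdeal_pi_quotient_torsion (ht : 0 < t) {J : (Ideal R)⁰}
    (hn : 0 < Module.finrank R N)
    (hJ : IsFreeProdIdeal R (N ⧸ Submodule.torsion R N) (Module.finrank R N - 1) (J : Ideal R)) :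
    IsFreeProdIdeal R (Fin t → N ⧸ Submodule.torsion R N) (t * Module.finrank R N - 1)
      ((J ^ t : (Ideal R)⁰) : Ideal R) := by
  have h := hJ.pi (nonZeroDivisors.coe_ne_zero J) (t - 1)
  rwa [Nat.sub_add_cancel ht, Nat.sub_add_cancel hn, ← SubmonoidClass.coe_pow] at h

theorem hasSplitSurjection_quotient_torsion_of_rank_lt (ht : 0 < t)
    (hn : 0 < Module.finrank R N) (h : 1 + t * Module.finrank R N ≤ Module.finrank R M) :
    HasSplitSurjection R (M ⧸ Submodule.torsion R M) (N ⧸ Submodule.torsion R N) t := by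
  obtain ⟨I, hI⟩ := exists_isFreeProdIdeal_quotient_torsion (R := R) (M := M) (by omega)
  obtain ⟨J, hJ⟩ := exists_isFreeProdIdeal_quotient_torsion (R := R) (M := N) hn
  have hJt := isFreeProdIdeal_pi_quotient_torsion ht hn hJ
  obtain ⟨x, hx, hx0⟩ := ((J ^ t : (Ideal R)⁰) : Ideal R).exists_mem_ne_zero_of_ne_bot
    (nonZeroDivisors.coe_ne_zero _)
  -- `J'` represents the inverse class of `J ^ t`, so a complement with ideal `J' * I` corrects the
  -- class: `J ^ t * (J' * I) = xI ≅ I`.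
  obtain ⟨J', hJ'⟩ := Ideal.dvd_span_singleton.mpr hx
  have hJ'0 : J' ≠ ⊥ := by
    rintro rfl
    exact hx0 (by simpa using hJ')
  have hC : J' * I ≠ ⊥ := mul_ne_zero hJ'0 (nonZeroDivisors.coe_ne_zero I)
  obtain ⟨e⟩ := Ideal.nonempty_linearEquiv_span_singleton_mul (I : Ideal R) hx0
  have hK := IsFreeProdIdeal.prod (nonZeroDivisors.coe_ne_zero (J ^ t)) hC hJt
    (⟨.refl R _⟩ : IsFreeProdIdeal R ((Fin (Module.finrank R M - 1 - t * Module.finrank R N) → R) ×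
      (J' * I : Ideal R)) _ _)
  have hpos : 0 < t * Module.finrank R N := by positivity
  rw [← mul_assoc, ← hJ', show t * Module.finrank R N - 1 +
    (Module.finrank R M - 1 - t * Module.finrank R N + 1) = Module.finrank R M - 1 by omega] at hK
  obtain ⟨e'⟩ := IsFreeProdIdeal.nonempty_linearEquiv
    (hI.map fun e' ↦ e'.trans ((LinearEquiv.refl R _).prodCongr e)) hK
  exact .of_linearEquiv_prod e'

theorem hasSplitSurjection_quotient_torsion_of_steinitzClass_eq (ht : 0 < t)
    (hn : 0 < Module.finrank R N) (h : Module.finrank R M = t * Module.finrank R N)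
    (hMN : steinitzClass R M = steinitzClass R N ^ t) :
    HasSplitSurjection R (M ⧸ Submodule.torsion R M) (N ⧸ Submodule.torsion R N) t := by
  obtain ⟨I, hI⟩ := exists_isFreeProdIdeal_quotient_torsion (R := R) (M := M)
    (by rw [h]; positivity)
  obtain ⟨J, hJ⟩ := exists_isFreeProdIdeal_quotient_torsion (R := R) (M := N) hn
  have hJt := isFreeProdIdeal_pi_quotient_torsion ht hn hJ
  rw [steinitzClass_eq hI, steinitzClass_eq hJ, ← map_pow, ClassGroup.mk0_eq_mk0_iff] at hMN
  obtain ⟨x, y, hx, hy, hxy⟩ := hMN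
  obtain ⟨e⟩ := Ideal.nonempty_linearEquiv_of_span_singleton_mul_eq hx hy hxy
  rw [← h] at hJt
  obtain ⟨e'⟩ := IsFreeProdIdeal.nonempty_linearEquiv
    (hI.map fun e' ↦ e'.trans ((LinearEquiv.refl R _).prodCongr e)) hJt
  exact .of_linearEquiv e'

theorem finrank_eq_of_surjective {f : M →ₗ[R] (Fin t → N)} (hf : Function.Surjective f) :
    Module.finrank R M = t * Module.finrank R N + Module.finrank R f.ker := by
  have h := Submodule.finrank_quotient_add_finrank f.ker
  rw [(f.quotKerEquivOfSurjective hf).finrank_eq] at h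
  rw [← h, Module.finrank_pi_const]

theorem steinitzClass_eq_pow_of_surjective (ht : 0 < t) (hn : 0 < Module.finrank R N)
    (h : Module.finrank R M = t * Module.finrank R N) {f : M →ₗ[R] (Fin t → N)}
    (hf : Function.Surjective f) : steinitzClass R M = steinitzClass R N ^ t := by
  obtain ⟨J, hJ⟩ := exists_isFreeProdIdeal_quotient_torsion (R := R) (M := N) hn
  have hJt := isFreeProdIdeal_pi_quotient_torsion ht hn hJ
  have hker : Module.IsTorsion R f.ker := by
    rw [← Module.finrank_eq_zero_iff_isTorsion]
    have := finrank_eq_of_surjective hf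
    omega
  let φ := (Submodule.torsion R N).mkQ.compLeft (Fin t) ∘ₗ f
  have hφ : Function.Surjective φ :=
    (Function.Surjective.comp_left (Submodule.mkQ_surjective _)).comp hf
  -- If `a` kills `f x`, then `a • x` lies in the torsion module `f.ker`, so a further `b` kills it
  -- and `b * a` kills `x`.
  have hkerφ : φ.ker = Submodule.torsion R M := by
    refine le_antisymm (fun x hx ↦ ?_) fun x hx ↦ ?_
    · have hfx : f x ∈ Submodule.torsion R (Fin t → N) :=
        Submodule.mem_torsion_of_forall_apply fun i ↦
          (Submodule.Quotient.mk_eq_zero _).mp (congrFun (LinearMap.mem_ker.mp hx) i)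
      obtain ⟨a, ha⟩ := hfx
      obtain ⟨b, hb⟩ := @hker ⟨a • x, LinearMap.mem_ker.mpr ((f.map_smul (a : R) x).trans ha)⟩
      exact ⟨b * a, (mul_smul b a x).trans (congrArg Subtype.val hb)⟩
    · exact LinearMap.mem_ker.mpr <| funext fun i ↦ (Submodule.Quotient.mk_eq_zero _).mpr <|
        (LinearMap.proj i ∘ₗ f).torsion_le_comap hx
  have e := φ.quotKerEquivOfSurjective hφ
  rw [hkerφ] at e
  rw [← h] at hJt
  rw [steinitzClass_eq hJ, steinitzClass_eq (hJt.congr e), map_pow]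

end Dedekind

theorem mainTheorem10 {R : Type u} [CommRing R] [IsDedekindDomain R]
    {M : Type v} [AddCommGroup M] [Module R M] [Module.Finite R M]
    {N : Type w} [AddCommGroup N] [Module R N] [Module.Finite R N]
    (t : ℕ) (ht : 0 < t) :
    ((t : ℕ∞) ≤ splittingCapacity R M N ↔
      (∀ (m : Ideal R) [m.IsPrime], m ∈ associatedPrimes R N \ {⊥} →
        (t : ℕ∞) ≤ localSplittingCapacity R m M N) ∧
      (Module.finrank R N = 0 ∨
        1 + t * Module.finrank R N ≤ Module.finrank R M ∨
        (Module.finrank R M = t * Module.finrank R N ∧ t ≤ t * Module.finrank R N ∧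
          steinitzClass R M = steinitzClass R N ^ t))) ∧
    ((t : ℕ∞) ≤ splittingCapacity R M N →
      (Module.finrank R M = t * Module.finrank R N ∧ t ≤ t * Module.finrank R N ∧
        steinitzClass R M = steinitzClass R N ^ t) →
      (t : ℕ∞) ≤ splittingCapacity R (Submodule.torsion R M) (Submodule.torsion R N) ∧
      splittingCapacity R M N = (t : ℕ∞)) := by
  simp only [localSplittingCapacity, le_splittingCapacity_iff]
  refine ⟨⟨fun h ↦ ⟨fun m _ _ ↦ h.localizedModule m.primeCompl, ?_⟩, fun ⟨hloc, hrank⟩ ↦ ?_⟩,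
    fun h ⟨hrank, hle, _⟩ ↦ ⟨h.torsion, le_antisymm (sSup_le ?_) (le_splittingCapacity_iff.mpr h)⟩⟩
  · obtain ⟨f, hf⟩ := h.exists_surjective
    have hr := finrank_eq_of_surjective hf
    rcases Nat.eq_zero_or_pos (Module.finrank R N) with hn | hn
    · exact .inl hn
    -- The rank of the kernel is the excess of `rank M` over `t * rank N`: zero gives condition (3),
    -- positive gives (2).
    rcases Nat.eq_zero_or_pos (Module.finrank R f.ker) with hk | hk
    · rw [hk, add_zero] at hr
      exact .inr (.inr ⟨hr, Nat.le_mul_of_pos_right t hn,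
        steinitzClass_eq_pow_of_surjective ht hn hr hf⟩)
    · exact .inr (.inl (by omega))
  · refine hasSplitSurjection_of_torsion_of_quotient
      (hasSplitSurjection_torsion_of_localized hloc) ?_
    rcases Nat.eq_zero_or_pos (Module.finrank R N) with hn | hn
    · have : Subsingleton (N ⧸ Submodule.torsion R N) := by
        rw [Submodule.Quotient.subsingleton_iff, Submodule.eq_top_iff']
        have hN : Module.IsTorsion R N := Module.finrank_eq_zero_iff_isTorsion.mp hn
        exact fun x ↦ @hN x
      exact .of_subsingleton
    rcases hrank with h | h | ⟨h, _, hMN⟩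
    · omega
    · exact hasSplitSurjection_quotient_torsion_of_rank_lt ht hn h
    · exact hasSplitSurjection_quotient_torsion_of_steinitzClass_eq ht hn h hMN
  · rintro _ ⟨s, rfl, hs⟩
    obtain ⟨f, hf⟩ := hs.exists_surjective
    have hr := finrank_eq_of_surjective hf
    -- `0 < t ≤ t * rank N` excludes rank zero, so `s * rank N ≤ rank M = t * rank N` yields `s ≤
    -- t`.
    have hn : 0 < Module.finrank R N := Nat.pos_of_mul_pos_left (ht.trans_le hle)
    exact_mod_cast Nat.le_of_mul_le_mul_right (c := Module.finrank R N) (by omega) hn
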